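/- Let $G=(V,E)$ be a finite strongly connected directed graph, with loops and multiple edges allowed; $\deg^+(v)$ is the number of edges with source $v$ (loops included). **Sinkless model.** A configuration is $c\in\mathbb N_0^V$. If $c(v)\ge\deg^+(v)$, then firing $v$ is legal: it removes $\deg^+(v)$ chips from $v$ and then sends one chip along each edge with source $v$. Write $c\to^* d$ if $d$ is obtained from $c$ by a finite sequence of legal firings. A configuration $c$ is *recurrent* if $c(v)\ge\deg^+(v)$ for some $v$ and $c\to^* d$ implies $d\to^* c$. On recurrent configurations $c\sim d:\Leftrightarrow c\to^* d$ is an equivalence relation, along which $\mathrm{lvl}(c)=\sum_{v}c(v)$ is constant. Put $\mathcal R(G;y)=\sum_{n\ge0}\#\{\text{classes of level }n\}\,y^n\in\mathbb Z[[y]]$. **Model with sink $s\in V$.** An $s$-configuration is $\hat c\in\mathbb N_0^{V\setminus\{s\}}$; vertices $v\ne s$ fire as before, and chips sent to $s$ are lost. Each $\hat c$ is carried by legal firings to a unique stable $s$-configuration $\hat c^\circ$ (stable: $\hat c^\circ(v)<\deg^+(v)$ for all $v\neq s$). An $s$-configuration $\hat c$ is *$s$-recurrent* if for each $s$-configuration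 $\hat c_1$ there is an $s$-configuration $\hat c_2$ with $(\hat c_1+\hat c_2)^\circ=\hat c$. Let $u_s(v)$ be the number of edges from $s$ to $v$. For $s$-recurrent $\hat c,\hat d$ put $\hat c\sim_s\hat d$ if $\hat d=(\hat c+k u_s)^\circ$ for some $k\in\mathbb N_0$. For an $s$-recurrent $\hat c$ let $\chi(\hat c)$ be the least $k\in\mathbb N_0$ such that the configuration equal to $\hat c$ off $s$ and to $k$ at $s$ is recurrent, and put $$\mathrm{slvl}(\hat c)=\chi(\hat c)+\sum_{v\ne s}\hat c(v),\qquad \mathrm{dlvl}(\hat c)=\deg^+(s)+\sum_{v\ne s}\hat c(v),\qquad \mathrm{dlvl}([\hat c])=\max_{\hat d\in[\hat c]}\mathrm{dlvl}(\hat d).$$ **Theorem.** For every $s\in V$: $\sim_s$ is an equivalence relation on the $s$-recurrent configurations, and for every $s$-recurrent $\hat c$ the index $\chi(\hat c)$ exists and $\mathrm{slvl}(\hat c)=\mathrm{dlvl}([\hat c])$; in particular $\mathrm{slvl}$ is constant on $\sim_s$-classes. With $$\mathcal B(G,s;y)=\sum_{[\hat c]}y^{\mathrm{dlvl}([\hat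 c])},\qquad \mathcal P(G,s;y)=\sum_{[\hat c]}y^{\mathrm{slvl}([\hat c])},$$ both sums over the finitely many $\sim_s$-classes of $s$-recurrent configurations, one has in $\mathbb Z[[y]]$ $$\mathcal B(G,s;y)=\mathcal P(G,s;y)=(1-y)\,\mathcal R(G;y).$$ Consequently the polynomial $\mathcal B(G,s;y)$ does not depend on $s$: $\mathcal B(G,s;y)=\mathcal B(G,t;y)$ for all $s,t\in V$. -/

import Mathlib

/-!
Finite directed multigraphs (loops and multiple edges allowed) are modelled by Mathlib's `Quiver`:
the vertices are the elements of a finite type `V`, the edges from `v` to `w` are the elements of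
the finite type `v ⟶ w`.
-/

universe u w

noncomputable section

namespace Sandpile

variable {V : Type u} [Fintype V] [DecidableEq V] [Quiver.{w + 1} V]

/-- The number of edges from `a` to `b`. -/
def mult (a b : V) : ℕ := Nat.card (a ⟶ b)

/-- The outdegree of `a`: the number of edges with source `a` (loops included). -/
def outDeg (a : V) : ℕ := ∑ b, mult a b

/-! ### The sinkless sandpile model -/

/-- The configuration obtained from `c` by firing `v` (meaningful if `outDeg v ≤ c v`): `v` loses
`outDeg v` chips, then one chip is sent along each edge leaving `v`. -/
def fire (c : V → ℕ) (v : V) : V → ℕ :=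
  fun x => (if x = v then c x - outDeg v else c x) + mult v x

/-- `d` is obtained from `c` by one legal firing move. -/
def LegalMove (c d : V → ℕ) : Prop := ∃ v, outDeg v ≤ c v ∧ d = fire c v

/-- `d` is obtained from `c` by a finite (possibly empty) sequence of legal firing moves. -/
def Accessible (c d : V → ℕ) : Prop := Relation.ReflTransGen LegalMove c d

def IsStable (c : V → ℕ) : Prop := ∀ v, c v < outDeg v

def IsRecurrent (c : V → ℕ) : Prop :=
  ¬ IsStable c ∧ ∀ d, Accessible c d → Accessible d c

/-- The level of a configuration: the number of chips. -/
def level (c : V → ℕ) : ℕ := ∑ v, c v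

/-- Accessibility is an equivalence relation on the recurrent configurations. -/
theorem equivalence_accessible :
    Equivalence (fun c d : {c : V → ℕ // IsRecurrent c} => Accessible c.1 d.1) where
  refl _ := Relation.ReflTransGen.refl
  symm {c _} h := c.2.2 _ h
  trans h₁ h₂ := Relation.ReflTransGen.trans h₁ h₂

theorem level_fire {c : V → ℕ} {v : V} (h : outDeg v ≤ c v) : level (fire c v) = level c := by
  unfold level fire
  rw [Finset.sum_add_distrib]
  change _ + outDeg v = _
  have h₁ : ∑ x ∈ Finset.univ.erase v, (if x = v then c x - outDeg v else c x) =
      ∑ x ∈ Finset.univ.erase v, c x :=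
    Finset.sum_congr rfl fun x hx => if_neg (Finset.ne_of_mem_erase hx)
  rw [← Finset.add_sum_erase _ _ (Finset.mem_univ v), h₁, if_pos rfl,
    ← Finset.add_sum_erase Finset.univ c (Finset.mem_univ v)]
  omega

/-- The level is constant on the classes of the accessibility relation. -/
theorem level_eq_of_accessible {c d : V → ℕ} (h : Accessible c d) : level d = level c := by
  induction h with
  | refl => rfl
  | tail _ h ih =>
    obtain ⟨v, hv, rfl⟩ := h
    rw [level_fire hv, ih]

/-- The equivalence class `[c]` of a recurrent configuration `c`. -/
def recClass (c : V → ℕ) : Set (V → ℕ) := {d | IsRecurrent d ∧ Accessible c d}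

variable (V) in
/-- The set of equivalence classes of recurrent configurations that have level `n`. -/
def recClassesOfLevel (n : ℕ) : Set (Set (V → ℕ)) :=
  recClass '' {c | IsRecurrent c ∧ level c = n}

theorem finite_recClassesOfLevel (n : ℕ) : (recClassesOfLevel V n).Finite := by
  refine Set.Finite.image _ ((Set.finite_Iic (fun _ : V => n)).subset ?_)
  rintro c ⟨-, hc⟩ v
  exact hc ▸ Finset.single_le_sum (f := c) (fun _ _ => Nat.zero_le _) (Finset.mem_univ v)

variable (V) in
/-- The generating function `R(G; y)` of the classes of recurrent configurations by level. -/
def recSeries : PowerSeries ℤ :=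
  PowerSeries.mk fun n => ((recClassesOfLevel V n).ncard : ℤ)

/-! ### The sandpile model with a sink -/

/-- The `s`-configurations: chips on the vertices other than the sink. -/
abbrev SConfig (s : V) : Type u := {v : V // v ≠ s} → ℕ

variable (s : V)

/-- The `s`-configuration obtained from `c` by firing `v ≠ s` (meaningful if `outDeg v ≤ c v`);
the chips that are sent to `s` disappear. -/
def sFire (c : SConfig s) (v : {v : V // v ≠ s}) : SConfig s :=
  fun x => (if x = v then c x - outDeg v.1 else c x) + mult v.1 x.1

/-- One legal `s`-firing move. (The trivial "firing of `s`", which changes nothing, is left out;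
it does not affect accessibility.) -/
def SLegalMove (c d : SConfig s) : Prop :=
  ∃ v : {v : V // v ≠ s}, outDeg v.1 ≤ c v ∧ d = sFire s c v

def SAccessible (c d : SConfig s) : Prop := Relation.ReflTransGen (SLegalMove s) c d

def IsSStable (c : SConfig s) : Prop := ∀ v, c v < outDeg v.1

/-- `c` stabilizes to `d`. On a strongly connected digraph there is exactly one such `d` for each
`c`, the stabilization of `c`, so that this says that the stabilization of `c` is `d`. -/
def StabilizesTo (c d : SConfig s) : Prop := SAccessible s c d ∧ IsSStable s d

/-- `c` is `s`-recurrent: for each `c₁` there is `c₂` such that the stabilization of `c₁ + c₂`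
is `c`. -/
def IsSRecurrent (c : SConfig s) : Prop :=
  ∀ c₁ : SConfig s, ∃ c₂ : SConfig s, StabilizesTo s (c₁ + c₂) c

/-- The `s`-Laplacian vector: the number of edges from `s` to each `v ≠ s`. -/
def sVec : SConfig s := fun v => mult s v.1

/-- The relation `c ~ₛ d`: the stabilization of `c + k • sVec s` is `d` for some `k ≥ 0`. -/
def SEquiv (c d : SConfig s) : Prop := ∃ k : ℕ, StabilizesTo s (c + k • sVec s) d

/-- The equivalence class `[c]` of an `s`-recurrent configuration `c`. -/
def sClass (c : SConfig s) : Set (SConfig s) := {d | IsSRecurrent s d ∧ SEquiv s c d}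

/-- The quotient set of the `s`-recurrent configurations by `~ₛ`. -/
def sClasses : Set (Set (SConfig s)) := sClass s '' {c | IsSRecurrent s c}

theorem finite_sRecurrent : {c : SConfig s | IsSRecurrent s c}.Finite := by
  refine (Set.finite_Iic (fun v : {v : V // v ≠ s} => outDeg v.1)).subset ?_
  intro c hc v
  obtain ⟨_, -, h⟩ := hc 0
  exact (h v).le

theorem finite_sClasses : (sClasses s).Finite := (finite_sRecurrent s).image _

/-- The configuration of the sinkless model that agrees with `c` off `s` and has `k` chips
at `s`. -/
def extend (c : SConfig s) (k : ℕ) : V → ℕ :=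
  fun v => if h : v = s then k else c ⟨v, h⟩

/-- The `s`-index of `c`: the least `k` for which `extend s c k` is recurrent. -/
def sIndex (c : SConfig s) : ℕ := sInf {k | IsRecurrent (extend s c k)}

/-- The `s`-level. -/
def sLevel (c : SConfig s) : ℕ := sIndex s c + ∑ v, c v

/-- The `d`-level. -/
def dLevel (c : SConfig s) : ℕ := outDeg s + ∑ v, c v

/-- The `d`-level of a class: the maximal `d`-level of its elements. -/
def classDLevel (A : Set (SConfig s)) : ℕ := sSup (dLevel s '' A)

/-- The Biggs-Merino polynomial `B(G, s; y)`. -/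
def biggsMerino : Polynomial ℤ :=
  ∑ A ∈ (finite_sClasses s).toFinset, Polynomial.X ^ classDLevel s A

/-- The set of classes of `s`-recurrent configurations that have `s`-level `n`. -/
def sClassesOfLevel (n : ℕ) : Set (Set (SConfig s)) :=
  sClass s '' {c | IsSRecurrent s c ∧ sLevel s c = n}

/-- The generating function `P(G, s; y)` of the `~ₛ`-classes by `s`-level. -/
def sSeries : PowerSeries ℤ :=
  PowerSeries.mk fun n => ((sClassesOfLevel s n).ncard : ℤ)

end Sandpile

end

/-!
The sinkless model and the model with sink `s` are compared through rounds: in a configuration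
`extend s c k` with `c` stable and `outDeg s ≤ k`, the vertex `s` fires and the other vertices
stabilize. A round replaces `c` by the stabilization of `c + sVec s` and keeps the level.

Two facts about legal firing sequences carry the argument. By the exchange property
(`LegalSeq.erase`), a legal firing that occurs somewhere in a legal sequence may be done first. By
strong connectivity, a nonempty closed sequence fires every vertex (`LegalSeq.mem_of_closed`).
Together they show that a configuration is recurrent as soon as a nonempty legal sequence leads back
to it (`isRecurrent_of_closed`), and that stabilization in the model with sink always terminates and
does not depend on the order of the firings.

In the model with sink, an `s`-stable `c` is `s`-recurrent exactly if `c + m • sVec s` stabilizes to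
`c` for some `m > 0` (`IsSRecurrent.exists_period`, `isSRecurrent_of_period`). Hence `~ₛ` is an
equivalence relation, whose classes are the orbits of adding `sVec s` and stabilizing.

For an `s`-recurrent `c` of class `A`, the configuration of level `n` that extends `c` is recurrent
if and only if `n` is at least the `d`-level of `A`: this is the condition that `s` can fire at the
start of each round as the rounds go through `A`, and then the rounds form a closed sequence
(`isRecurrent_of_classDLevel_le`, `classDLevel_le_of_isRecurrent`). This gives the `s`-index and the
equality of the two levels. Each class of recurrent configurations of level `n` contains an
extension of an `s`-recurrent configuration, and firings of `s` are additions of `sVec s` off the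
sink, so these classes correspond to the `~ₛ`-classes of `d`-level at most `n` (`injOn_sTrace`,
`image_sTrace`). The coefficients of the recurrent series are therefore the partial sums of those of
the Biggs-Merino polynomial.
-/

universe u₁

namespace Sandpile

/-! ### Legal sequences of topplings -/

section LegalSequences

variable {ι : Type u₁} [DecidableEq ι] (deg : ι → ℕ) (A : ι → ι → ℕ)

/-- Toppling `v` in a chip system with thresholds `deg` and transfer numbers `A`: `v` loses `deg v`
chips and each `x` receives `A v x`. Both `fire` and `sFire` are of this form by definition. -/
def topple (c : ι → ℕ) (v : ι) : ι → ℕ :=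
  fun x => (if x = v then c x - deg v else c x) + A v x

/-- One legal toppling; `LegalMove` and `SLegalMove` are of this form by definition. -/
def ToppleMove (c d : ι → ℕ) : Prop := ∃ v, deg v ≤ c v ∧ d = topple deg A c v

/-- `LegalSeq deg A c l d`: toppling the entries of the list `l` in order is legal from `c` and
leads to `d`. -/
inductive LegalSeq : (ι → ℕ) → List ι → (ι → ℕ) → Prop
  | nil (c : ι → ℕ) : LegalSeq c [] c
  | cons {c d : ι → ℕ} {v : ι} {l : List ι} (hv : deg v ≤ c v)
      (h : LegalSeq (topple deg A c v) l d) : LegalSeq c (v :: l) d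

variable {deg A} {c d e : ι → ℕ} {v w : ι} {l l' : List ι}

theorem LegalSeq.append (h : LegalSeq deg A c l d) (h' : LegalSeq deg A d l' e) :
    LegalSeq deg A c (l ++ l') e := by
  induction h with
  | nil => exact h'
  | cons hv _ ih => exact .cons hv (ih h')

theorem LegalSeq.reachable (h : LegalSeq deg A c l d) :
    Relation.ReflTransGen (ToppleMove deg A) c d := by
  induction h with
  | nil => exact .refl
  | cons hv _ ih => exact .head ⟨_, hv, rfl⟩ ih

theorem exists_legalSeq (h : Relation.ReflTransGen (ToppleMove deg A) c d) :
    ∃ l, LegalSeq deg A c l d := by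
  induction h with
  | refl => exact ⟨[], .nil _⟩
  | tail _ h ih =>
    obtain ⟨l, hl⟩ := ih
    obtain ⟨v, hv, rfl⟩ := h
    exact ⟨l ++ [v], hl.append (.cons hv (.nil _))⟩

theorem le_topple (h : w ≠ v) : c w ≤ topple deg A c v w := by
  simp [topple, h]

theorem topple_comm (h : v ≠ w) (hv : deg v ≤ c v) (hw : deg w ≤ c w) :
    topple deg A (topple deg A c v) w = topple deg A (topple deg A c w) v := by
  funext x
  by_cases h₁ : x = v
  · subst h₁
    simp only [topple, if_neg h, if_true]
    omega
  · by_cases h₂ : x = w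
    · subst h₂
      simp only [topple, if_neg h₁, if_true]
      omega
    · simp only [topple, if_neg h₁, if_neg h₂]
      omega

theorem topple_add (hv : deg v ≤ c v) (e : ι → ℕ) :
    topple deg A (c + e) v = topple deg A c v + e := by
  funext x
  by_cases h : x = v
  · subst h
    simp only [topple, if_true, Pi.add_apply]
    omega
  · simp only [topple, if_neg h, Pi.add_apply]
    omega

theorem reachable_add (h : Relation.ReflTransGen (ToppleMove deg A) c d) (e : ι → ℕ) :
    Relation.ReflTransGen (ToppleMove deg A) (c + e) (d + e) := by
  induction h with
  | refl => exact .refl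
  | tail _ h ih =>
    obtain ⟨v, hv, rfl⟩ := h
    exact ih.tail ⟨v, hv.trans (Nat.le_add_right _ _), (topple_add hv e).symm⟩

/-- The exchange property: a legal toppling that occurs in a legal sequence can be moved to the
front of it. -/
theorem LegalSeq.erase (h : LegalSeq deg A c l d) (hv : deg v ≤ c v) (hl : v ∈ l) :
    LegalSeq deg A (topple deg A c v) (l.erase v) d := by
  induction h with
  | nil => simp at hl
  | @cons c d w l hw h ih =>
    by_cases hvw : w = v
    · subst hvw
      simpa using h
    · have hl' : v ∈ l := by
        rcases List.mem_cons.1 hl with h' | h'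
        · exact absurd h'.symm hvw
        · exact h'
      rw [List.erase_cons_tail (by simpa using hvw)]
      refine .cons (hw.trans (le_topple hvw)) ?_
      rw [topple_comm (Ne.symm hvw) hv hw]
      exact ih (hv.trans (le_topple (Ne.symm hvw))) hl'

theorem LegalSeq.le_of_notMem (h : LegalSeq deg A c l d) (hl : v ∉ l) : c v ≤ d v := by
  induction h with
  | nil => exact le_rfl
  | cons _ _ ih =>
    rw [List.mem_cons, not_or] at hl
    exact (le_topple hl.1).trans (ih hl.2)

/-- A stable configuration that is reachable from `c` stays reachable whatever is toppled. -/
theorem reachable_of_stable (hcd : Relation.ReflTransGen (ToppleMove deg A) c d)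
    (hd : ∀ v, d v < deg v) (hce : Relation.ReflTransGen (ToppleMove deg A) c e) :
    Relation.ReflTransGen (ToppleMove deg A) e d := by
  induction hce with
  | refl => exact hcd
  | tail _ h ih =>
    obtain ⟨v, hv, rfl⟩ := h
    obtain ⟨l, hl⟩ := exists_legalSeq ih
    have hvl : v ∈ l := by
      by_contra hvl
      exact absurd (hv.trans (hl.le_of_notMem hvl)) (not_le.2 (hd v))
    exact (hl.erase hv hvl).reachable

theorem eq_of_stable (hd : ∀ v, d v < deg v)
    (h : Relation.ReflTransGen (ToppleMove deg A) d e) : e = d := by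
  rcases Relation.ReflTransGen.cases_head h with h | ⟨_, ⟨v, hv, -⟩, -⟩
  · exact h.symm
  · exact absurd hv (not_le.2 (hd v))

/-- The chip balance of a legal sequence at the vertex `x`. -/
theorem LegalSeq.balance [Fintype ι] (h : LegalSeq deg A c l d) (x : ι) :
    d x + l.count x * deg x = c x + ∑ v, l.count v * A v x := by
  induction h with
  | nil => simp
  | @cons c d w l hw h ih =>
    have hs : ∑ v, (w :: l).count v * A v x = ∑ v, l.count v * A v x + A w x := by
      simp [List.count_cons, add_mul, Finset.sum_add_distrib]
    rw [hs]
    by_cases hx : x = w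
    · subst hx
      simp only [topple, if_true] at ih
      rw [List.count_cons_self, add_mul, one_mul]
      omega
    · simp only [topple, if_neg hx] at ih
      rw [List.count_cons_of_ne (Ne.symm hx)]
      omega

end LegalSequences

/-! ### Recurrence in the sinkless model -/

theorem mult_pos {V : Type u} [Quiver.{w + 1} V] {a b : V} [Finite (a ⟶ b)] (e : a ⟶ b) :
    0 < mult a b :=
  have : Nonempty (a ⟶ b) := ⟨e⟩
  Nat.card_pos

section Sinkless

variable {V : Type u} [Fintype V] [DecidableEq V] [Quiver.{w + 1} V]

theorem IsRecurrent.of_accessible {c d : V → ℕ} (hc : IsRecurrent c) (h : Accessible c d) :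
    IsRecurrent d := by
  refine ⟨fun hd => hc.1 ?_, fun e he => (hc.2 e (h.trans he)).trans h⟩
  have hdc : c = d := eq_of_stable hd (hc.2 d h)
  rwa [hdc]

theorem recClass_eq_iff {c d : V → ℕ} (hc : IsRecurrent c) (hd : IsRecurrent d) :
    recClass c = recClass d ↔ Accessible c d := by
  constructor
  · intro h
    have hd' : d ∈ recClass d := ⟨hd, .refl⟩
    rw [← h] at hd'
    exact hd'.2
  · intro h
    ext e
    exact ⟨fun he => ⟨he.1, (hc.2 d h).trans he.2⟩, fun he => ⟨he.1, h.trans he.2⟩⟩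

variable [∀ a b : V, Finite (a ⟶ b)]

/-- A nonempty legal sequence that returns to its starting point fires every vertex: by the chip
balance, a vertex that does not fire has no in-neighbour that fires. -/
theorem LegalSeq.mem_of_closed (hG : Quiver.IsStronglyConnected V) {c : V → ℕ} {l : List V}
    (h : LegalSeq outDeg mult c l c) (hl : l ≠ []) (v : V) : v ∈ l := by
  have key : ∀ {a b : V}, Quiver.Path a b → l.count b = 0 → l.count a = 0 := by
    intro a b p
    induction p with
    | nil => exact id
    | @cons x y p e ih =>
      intro hb
      refine ih ?_
      have hbal := h.balance y
      rw [hb, zero_mul] at hbal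
      have hsum : ∑ v, l.count v * mult v y = 0 := by omega
      have hx := Finset.sum_eq_zero_iff.1 hsum x (Finset.mem_univ x)
      exact (mul_eq_zero.1 hx).resolve_right (mult_pos e).ne'
  obtain ⟨a, l', rfl⟩ := List.exists_cons_of_ne_nil hl
  by_contra hv
  obtain ⟨p⟩ := hG a v
  simpa using key p (List.count_eq_zero.2 hv)

/-- A configuration that can return to itself after a legal firing is recurrent: any legal firing
occurs in the closed sequence, so it can be moved to its front, and the rest of the sequence
undoes it. -/
theorem isRecurrent_of_closed (hG : Quiver.IsStronglyConnected V) {c : V → ℕ} {v : V}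
    (hv : outDeg v ≤ c v) (h : Accessible (fire c v) c) : IsRecurrent c := by
  refine ⟨fun hs => absurd hv (not_le.2 (hs v)), ?_⟩
  obtain ⟨l₀, hl₀⟩ := exists_legalSeq h
  have hcl : ∃ l, l ≠ [] ∧ LegalSeq outDeg mult c l c := ⟨v :: l₀, by simp, .cons hv hl₀⟩
  intro d hd
  suffices H : (∃ l, l ≠ [] ∧ LegalSeq outDeg mult d l d) ∧ Accessible d c from H.2
  induction hd with
  | refl => exact ⟨hcl, .refl⟩
  | tail _ h ih =>
    obtain ⟨w, hw, rfl⟩ := h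
    obtain ⟨⟨l, hne, hl⟩, hdc⟩ := ih
    have hle := hl.erase hw (hl.mem_of_closed hG hne w)
    exact ⟨⟨_, by simp, hle.append (.cons hw (.nil _))⟩,
      Relation.ReflTransGen.trans hle.reachable hdc⟩

end Sinkless

/-! ### Passing between the two models -/

section Extend

variable {V : Type u} [DecidableEq V] {s : V}

theorem extend_self (c : SConfig s) (k : ℕ) : extend s c k s = k := by simp [extend]

theorem extend_val (c : SConfig s) (k : ℕ) (v : {v : V // v ≠ s}) : extend s c k v.1 = c v := by
  simp [extend, v.2]

theorem extend_restrict (c : V → ℕ) : extend s (fun v => c v.1) (c s) = c := by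
  funext v
  by_cases h : v = s <;> simp [extend, h]

theorem level_extend [Fintype V] (c : SConfig s) (k : ℕ) : level (extend s c k) = k + ∑ v, c v := by
  have h : ∑ v : {v : V // v ≠ s}, c v = ∑ v ∈ Finset.univ.erase s, extend s c k v := by
    simp only [← extend_val c k]
    exact (Finset.sum_subtype (Finset.univ.erase s) (by simp) (extend s c k)).symm
  rw [level, ← Finset.add_sum_erase _ _ (Finset.mem_univ s), extend_self, h]

end Extend

section Transfer

variable {V : Type u} [Fintype V] [DecidableEq V] [Quiver.{w + 1} V] {s : V}

theorem fire_extend (c : SConfig s) (k : ℕ) (v : {v : V // v ≠ s}) :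
    fire (extend s c k) v.1 = extend s (sFire s c v) (k + mult v.1 s) := by
  funext x
  by_cases h : x = s
  · subst h
    simp [fire, extend, Ne.symm v.2]
  · simp [fire, extend, sFire, h, Subtype.ext_iff]

theorem fire_extend_sink (c : SConfig s) (k : ℕ) :
    fire (extend s c k) s = extend s (c + sVec s) (k - outDeg s + mult s s) := by
  funext x
  by_cases h : x = s
  · subst h
    simp [fire, extend]
  · simp [fire, extend, sVec, h]

/-- Firings in the model with sink are firings of the sinkless model in which `s` collects the
chips that reach it. -/
theorem LegalSeq.extend {c d : SConfig s} {l : List {v : V // v ≠ s}}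
    (h : LegalSeq (fun v : {v : V // v ≠ s} => outDeg v.1) (fun v x => mult v.1 x.1) c l d)
    (k : ℕ) : ∃ k', LegalSeq outDeg mult (extend s c k) (l.map Subtype.val) (extend s d k') := by
  induction h generalizing k with
  | nil => exact ⟨k, .nil _⟩
  | @cons c d v l hv _ ih =>
    obtain ⟨k', h'⟩ := ih (k + mult v.1 s)
    refine ⟨k', .cons ((extend_val c k v).symm ▸ hv) ?_⟩
    have := fire_extend c k v
    unfold fire at this
    unfold topple
    rw [this]
    exact h'

theorem SAccessible.exists_extend {c d : SConfig s} (h : SAccessible s c d) (k : ℕ) :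
    ∃ l, l + ∑ v, d v = k + ∑ v, c v ∧ Accessible (extend s c k) (extend s d l) := by
  obtain ⟨L, hL⟩ := exists_legalSeq h
  obtain ⟨l, hl⟩ := hL.extend k
  have hacc : Accessible (extend s c k) (Sandpile.extend s d l) := hl.reachable
  refine ⟨l, ?_, hacc⟩
  rw [← level_extend, ← level_extend, level_eq_of_accessible hacc]

theorem SAccessible.extend {c d : SConfig s} (h : SAccessible s c d) {k l : ℕ}
    (hkl : l + ∑ v, d v = k + ∑ v, c v) : Accessible (extend s c k) (extend s d l) := by
  obtain ⟨l', h₁, h₂⟩ := h.exists_extend k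
  obtain rfl : l' = l := by omega
  exact h₂

theorem SAccessible.add {c d : SConfig s} (h : SAccessible s c d) (e : SConfig s) :
    SAccessible s (c + e) (d + e) := reachable_add h e

theorem SAccessible.add_add {c d c' d' : SConfig s} (h : SAccessible s c d)
    (h' : SAccessible s c' d') : SAccessible s (c + c') (d + d') := by
  refine Relation.ReflTransGen.trans (h.add c') ?_
  rw [add_comm d, add_comm d]
  exact h'.add d

/-- Off the sink, firings of `s` act as additions of `sVec s`. -/
theorem Accessible.restrict {c d : V → ℕ} (h : Accessible c d) (s : V) :
    ∃ m : ℕ, SAccessible s ((fun v => c v.1) + m • sVec s) (fun v => d v.1) := by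
  induction h with
  | refl => exact ⟨0, by rw [zero_smul, add_zero]; exact .refl⟩
  | @tail d _ _ h ih =>
    obtain ⟨m, hm⟩ := ih
    obtain ⟨v, hv, rfl⟩ := h
    by_cases hvs : v = s
    · subst hvs
      refine ⟨m + 1, ?_⟩
      have : (fun x : {x : V // x ≠ v} => fire d v x.1) = (fun x => d x.1) + sVec v := by
        funext x
        simp [fire, sVec, x.2]
      rw [this, add_smul, one_smul, ← add_assoc]
      exact hm.add _
    · refine ⟨m, Relation.ReflTransGen.tail hm ⟨⟨v, hvs⟩, hv, ?_⟩⟩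
      funext x
      simp [fire, sFire, Subtype.ext_iff]

theorem StabilizesTo.of_accessible {c d e : SConfig s} (h : StabilizesTo s c d)
    (h' : SAccessible s c e) : StabilizesTo s e d :=
  ⟨reachable_of_stable h.1 h.2 h', h.2⟩

theorem StabilizesTo.trans_add {a b c x : SConfig s} (h : StabilizesTo s a b)
    (h' : StabilizesTo s (b + x) c) : StabilizesTo s (a + x) c :=
  ⟨Relation.ReflTransGen.trans (h.1.add x) h'.1, h'.2⟩

theorem StabilizesTo.of_add {a b c x : SConfig s} (h : StabilizesTo s a b)
    (h' : StabilizesTo s (a + x) c) : StabilizesTo s (b + x) c :=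
  h'.of_accessible (h.1.add x)

theorem IsSStable.eq_of_stabilizesTo {c d : SConfig s} (hc : IsSStable s c)
    (h : StabilizesTo s c d) : d = c := eq_of_stable hc h.1

theorem IsSStable.stabilizesTo {c : SConfig s} (hc : IsSStable s c) : StabilizesTo s c c :=
  ⟨.refl, hc⟩

theorem IsSRecurrent.isSStable {c : SConfig s} (h : IsSRecurrent s c) : IsSStable s c := by
  obtain ⟨_, h⟩ := h 0
  exact h.2

theorem IsSRecurrent.of_stabilizesTo {c d x : SConfig s} (h : IsSRecurrent s c)
    (h' : StabilizesTo s (c + x) d) : IsSRecurrent s d := by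
  intro c₁
  obtain ⟨c₂, h₂⟩ := h c₁
  refine ⟨c₂ + x, ?_⟩
  rw [← add_assoc]
  exact h₂.trans_add h'

theorem StabilizesTo.mul_period {c : SConfig s} {m : ℕ} (h : StabilizesTo s (c + m • sVec s) c)
    (n : ℕ) : StabilizesTo s (c + (n * m) • sVec s) c := by
  induction n with
  | zero =>
    rw [zero_mul, zero_smul, add_zero]
    exact h.2.stabilizesTo
  | succ n ih =>
    rw [add_mul, one_mul, add_smul, ← add_assoc]
    exact ih.trans_add h

theorem SEquiv.trans {c d e : SConfig s} (h : SEquiv s c d) (h' : SEquiv s d e) :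
    SEquiv s c e := by
  obtain ⟨k, hk⟩ := h
  obtain ⟨l, hl⟩ := h'
  refine ⟨k + l, ?_⟩
  rw [add_smul, ← add_assoc]
  exact hk.trans_add hl

theorem IsSRecurrent.sEquiv_refl {c : SConfig s} (hc : IsSRecurrent s c) : SEquiv s c c :=
  ⟨0, by rw [zero_smul, add_zero]; exact hc.isSStable.stabilizesTo⟩

theorem IsSRecurrent.mem_sClass {c : SConfig s} (hc : IsSRecurrent s c) : c ∈ sClass s c :=
  ⟨hc, hc.sEquiv_refl⟩

variable [∀ a b : V, Finite (a ⟶ b)]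

/-- Stabilization terminates: the number of chips does not grow, and a closed sequence of moves
would be one of the sinkless model in which `s` does not fire. -/
theorem exists_stabilizesTo (hG : Quiver.IsStronglyConnected V) (c : SConfig s) :
    ∃ d, StabilizesTo s c d := by
  have hfin : {d | SAccessible s c d}.Finite := by
    refine (Set.finite_Iic (fun _ : {v : V // v ≠ s} => ∑ v, c v)).subset fun d hd v => ?_
    obtain ⟨l, hl, -⟩ := SAccessible.exists_extend hd 0
    have := Finset.single_le_sum (f := d) (fun _ _ => Nat.zero_le _) (Finset.mem_univ v)
    simp only
    omega
  have : Finite {d // SAccessible s c d} := hfin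
  let r : {d // SAccessible s c d} → {d // SAccessible s c d} → Prop :=
    fun a b => Relation.TransGen (SLegalMove s) b.1 a.1
  have : IsTrans _ r := ⟨fun _ _ _ h₁ h₂ => Relation.TransGen.trans h₂ h₁⟩
  have : Std.Irrefl r := by
    refine ⟨fun a ha => ?_⟩
    obtain ⟨b, ⟨v, hv, rfl⟩, hb⟩ := Relation.TransGen.head'_iff.1 ha
    obtain ⟨l, hl⟩ := exists_legalSeq hb
    obtain ⟨k, hk⟩ := LegalSeq.extend (LegalSeq.cons hv hl) 0
    have hlev := level_eq_of_accessible (show Accessible _ _ from hk.reachable)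
    rw [level_extend, level_extend] at hlev
    obtain rfl : k = 0 := by omega
    obtain ⟨x, -, hx⟩ := List.mem_map.1 (hk.mem_of_closed hG (by simp) s)
    exact x.2 hx
  obtain ⟨d, -, hd⟩ := (Finite.wellFounded_of_trans_of_irrefl r).has_min Set.univ
    ⟨⟨c, .refl⟩, trivial⟩
  refine ⟨d.1, d.2, fun v => ?_⟩
  by_contra hv
  have hmove : SLegalMove s d.1 (sFire s d.1 v) := ⟨v, not_lt.1 hv, rfl⟩
  exact hd ⟨_, Relation.ReflTransGen.tail d.2 hmove⟩ trivial (.single hmove)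

end Transfer

/-! ### Recurrence in the model with sink -/

theorem single_one_le {ι : Type u₁} [DecidableEq ι] {f : ι → ℕ} {i : ι} (h : 1 ≤ f i) :
    Pi.single i 1 ≤ f := by
  intro j
  by_cases hj : j = i
  · subst hj
    simpa using h
  · simp [hj]

section Sink

variable {V : Type u} [Fintype V] [DecidableEq V] [Quiver.{w + 1} V]
  [∀ a b : V, Finite (a ⟶ b)] {s : V}

/-- Chips entering from the sink can be moved to any given vertex, along a path from `s`. -/
theorem exists_sAccessible_pos {v : V} (p : Quiver.Path s v) (hv : v ≠ s) :
    ∃ (K : ℕ) (d : SConfig s), SAccessible s (K • sVec s) d ∧ 1 ≤ d ⟨v, hv⟩ := by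
  induction p with
  | nil => exact absurd rfl hv
  | @cons b v p e ih =>
    by_cases hb : b = s
    · subst hb
      refine ⟨1, sVec b, ?_, mult_pos e⟩
      rw [one_smul]
      exact .refl
    · obtain ⟨K, d, hd, hdb⟩ := ih hb
      have hmul : ∀ n : ℕ, SAccessible s ((n * K) • sVec s) (n • d) := by
        intro n
        induction n with
        | zero =>
          rw [zero_mul, zero_smul, zero_smul]
          exact .refl
        | succ n ihn =>
          rw [add_mul, one_mul, add_smul, add_smul, one_smul]
          exact ihn.add_add hd
      refine ⟨outDeg b * K, sFire s (outDeg b • d) ⟨b, hb⟩,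
        Relation.ReflTransGen.tail (hmul _) ⟨⟨b, hb⟩, ?_, rfl⟩, ?_⟩
      · exact Nat.le_mul_of_pos_right _ hdb
      · have := mult_pos e
        simp only [sFire]
        omega

theorem exists_sAccessible_ge (hG : Quiver.IsStronglyConnected V) (c : SConfig s) :
    ∃ (K : ℕ) (d : SConfig s), SAccessible s (K • sVec s) d ∧ c ≤ d := by
  have key : ∀ (N : ℕ) (c : SConfig s), ∑ v, c v = N →
      ∃ (K : ℕ) (d : SConfig s), SAccessible s (K • sVec s) d ∧ c ≤ d := by
    intro N
    induction N with
    | zero =>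
      intro c hc
      refine ⟨0, 0, by rw [zero_smul]; exact .refl, fun v => ?_⟩
      exact ((Finset.sum_eq_zero_iff.1 hc) v (Finset.mem_univ v)).le
    | succ N ih =>
      intro c hc
      obtain ⟨v, -, hv⟩ := Finset.exists_ne_zero_of_sum_ne_zero (hc.trans_ne N.succ_ne_zero)
      have hle : Pi.single v 1 ≤ c := single_one_le (Nat.one_le_iff_ne_zero.2 hv)
      obtain ⟨c', rfl⟩ := exists_add_of_le hle
      obtain ⟨K, d, hd, hcd⟩ := ih c' (by
        simp only [Pi.add_apply, Finset.sum_add_distrib, Finset.sum_pi_single',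
          Finset.mem_univ, if_true] at hc
        omega)
      obtain ⟨K', d', hd', hv'⟩ := exists_sAccessible_pos (hG s v.1).some v.2
      refine ⟨K' + K, d' + d, by rw [add_smul]; exact hd'.add_add hd, ?_⟩
      exact add_le_add (single_one_le hv') hcd
  exact key _ c rfl

/-- Chips from the sink dominate any given configuration, so a stable configuration that adding
`m + 1` copies of `sVec s` reproduces is reached from beyond any given one. -/
theorem isSRecurrent_of_period (hG : Quiver.IsStronglyConnected V) {c : SConfig s} {m : ℕ}
    (h : StabilizesTo s (c + (m + 1) • sVec s) c) : IsSRecurrent s c := by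
  intro c₁
  obtain ⟨K, d, hd, hcd⟩ := exists_sAccessible_ge hG c₁
  obtain ⟨c₂, rfl⟩ := exists_add_of_le hcd
  have hK := h.mul_period K
  have hle : K ≤ K * (m + 1) := Nat.le_mul_of_pos_right _ m.succ_pos
  obtain ⟨j, hj⟩ := exists_add_of_le hle
  rw [hj, add_smul, add_left_comm] at hK
  refine ⟨c₂ + (c + j • sVec s), ?_⟩
  rw [← add_assoc]
  exact hK.of_accessible (hd.add _)

/-- An `s`-recurrent configuration returns to itself after finitely many additions of `sVec s`:
two of the stabilizations of `c + n • sVec s` coincide, say in `e`, and `c` is the stabilization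
of `e + x` for some `x`. -/
theorem IsSRecurrent.exists_period (hG : Quiver.IsStronglyConnected V) {c : SConfig s}
    (hc : IsSRecurrent s c) : ∃ m : ℕ, StabilizesTo s (c + (m + 1) • sVec s) c := by
  choose f hf using fun n : ℕ => exists_stabilizesTo hG (c + n • sVec s)
  obtain ⟨i, j, hij, hfij⟩ := Set.Finite.exists_lt_map_eq_of_forall_mem
    (fun n => show f n ∈ {c | IsSRecurrent s c} from hc.of_stabilizesTo (hf n))
    (finite_sRecurrent s)
  obtain ⟨m, rfl⟩ := Nat.exists_eq_add_of_lt hij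
  have he : StabilizesTo s (f i + (m + 1) • sVec s) (f i) := by
    refine (hf i).of_add ?_
    rw [add_assoc, ← add_smul, ← add_assoc i, hfij]
    exact hf _
  obtain ⟨x, hx⟩ := hc (f i)
  refine ⟨m, hx.of_add ?_⟩
  rw [add_right_comm]
  exact he.trans_add hx

theorem SEquiv.symm_of_isSRecurrent (hG : Quiver.IsStronglyConnected V) {c d : SConfig s}
    (hc : IsSRecurrent s c) (h : SEquiv s c d) : SEquiv s d c := by
  obtain ⟨k, hk⟩ := h
  obtain ⟨m, hm⟩ := hc.exists_period hG
  have hle : k ≤ k * (m + 1) := Nat.le_mul_of_pos_right _ m.succ_pos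
  obtain ⟨j, hj⟩ := exists_add_of_le hle
  have hK := hm.mul_period k
  rw [hj, add_smul, ← add_assoc] at hK
  exact ⟨j, hk.of_add hK⟩

theorem equivalence_sEquiv (hG : Quiver.IsStronglyConnected V) (s : V) :
    Equivalence (fun c d : {c : SConfig s // IsSRecurrent s c} => SEquiv s c.1 d.1) where
  refl c := c.2.sEquiv_refl
  symm {c _} h := h.symm_of_isSRecurrent hG c.2
  trans h₁ h₂ := h₁.trans h₂

theorem sClass_eq_of_mem (hG : Quiver.IsStronglyConnected V) {c d : SConfig s}
    (hc : IsSRecurrent s c) (h : d ∈ sClass s c) : sClass s d = sClass s c := by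
  ext e
  exact ⟨fun he => ⟨he.1, h.2.trans he.2⟩,
    fun he => ⟨he.1, (h.2.symm_of_isSRecurrent hG hc).trans he.2⟩⟩

end Sink

/-! ### Levels -/

section Levels

variable {V : Type u} [Fintype V] [DecidableEq V] [Quiver.{w + 1} V] {s : V}

/-- One round of the sinkless model: `s` fires, and the other vertices stabilize. -/
theorem accessible_round {c d : SConfig s} (h : StabilizesTo s (c + sVec s) d) {k l : ℕ}
    (hk : outDeg s ≤ k) (hkl : l + ∑ v, d v = k + ∑ v, c v) :
    Accessible (fire (extend s c k) s) (extend s d l) := by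
  have hlev := level_fire (c := extend s c k) (v := s) (by rwa [extend_self])
  rw [fire_extend_sink] at hlev ⊢
  rw [level_extend, level_extend] at hlev
  exact h.1.extend (by omega)

theorem legalMove_sink {c : SConfig s} {k : ℕ} (hk : outDeg s ≤ k) :
    LegalMove (extend s c k) (fire (extend s c k) s) := ⟨s, by rwa [extend_self], rfl⟩

theorem IsRecurrent.outDeg_le {c : SConfig s} {k : ℕ} (h : IsRecurrent (extend s c k))
    (hc : IsSStable s c) : outDeg s ≤ k := by
  by_contra hk
  refine h.1 fun v => ?_
  by_cases hv : v = s
  · subst hv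
    rw [extend_self]
    omega
  · exact (extend_val c k ⟨v, hv⟩).trans_lt (hc ⟨v, hv⟩)

theorem bddAbove_dLevel (A : Set (SConfig s)) (hA : A ⊆ {c | IsSRecurrent s c}) :
    BddAbove (dLevel s '' A) :=
  (((finite_sRecurrent s).subset hA).image _).bddAbove

theorem dLevel_le_classDLevel {c d : SConfig s} (h : d ∈ sClass s c) :
    dLevel s d ≤ classDLevel s (sClass s c) :=
  le_csSup (bddAbove_dLevel _ fun _ h => h.1) ⟨d, h, rfl⟩

variable [∀ a b : V, Finite (a ⟶ b)]

/-- The rounds that start from a recurrent extension of `c` run through the whole class of `c`. -/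
theorem IsRecurrent.exists_accessible (hG : Quiver.IsStronglyConnected V) {c d : SConfig s}
    {k : ℕ} (h : IsRecurrent (extend s c k)) (hc : IsSStable s c) (hd : SEquiv s c d) :
    ∃ l, l + ∑ v, d v = k + ∑ v, c v ∧ Accessible (extend s c k) (extend s d l) := by
  obtain ⟨j, hj⟩ := hd
  induction j generalizing d with
  | zero =>
    rw [zero_smul, add_zero] at hj
    obtain rfl := hc.eq_of_stabilizesTo hj
    exact ⟨k, rfl, .refl⟩
  | succ j ih =>
    obtain ⟨e, he⟩ := exists_stabilizesTo hG (c + j • sVec s)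
    obtain ⟨l, hl, hacc⟩ := ih he
    rw [add_smul, one_smul, ← add_assoc] at hj
    have hed := he.of_add hj
    have hle := (h.of_accessible hacc).outDeg_le he.2
    obtain ⟨l', hl', -⟩ := SAccessible.exists_extend hed.1 (l - outDeg s + mult s s)
    have hlev := level_fire (c := extend s e l) (v := s) (by rwa [extend_self])
    rw [fire_extend_sink, level_extend, level_extend] at hlev
    have hl'' : l' + ∑ v, d v = l + ∑ v, e v := by omega
    exact ⟨l', by omega, hacc.trans (.head (legalMove_sink hle) (accessible_round hed hle hl''))⟩

theorem classDLevel_le_of_isRecurrent (hG : Quiver.IsStronglyConnected V) {c : SConfig s} {k : ℕ}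
    (hc : IsSRecurrent s c) (h : IsRecurrent (extend s c k)) :
    classDLevel s (sClass s c) ≤ k + ∑ v, c v := by
  refine csSup_le ⟨_, c, hc.mem_sClass, rfl⟩ ?_
  rintro _ ⟨d, hd, rfl⟩
  obtain ⟨l, hl, hacc⟩ := h.exists_accessible hG hc.isSStable hd.2
  have := (h.of_accessible hacc).outDeg_le hd.1.isSStable
  unfold dLevel
  omega

/-- If every member of the class of `c` has `d`-level at most `n`, then at level `n` the vertex `s`
is ready to fire at the start of each round. -/
theorem accessible_of_classDLevel_le (hG : Quiver.IsStronglyConnected V) {c d : SConfig s}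
    (hc : IsSRecurrent s c) {n j : ℕ} (hn : classDLevel s (sClass s c) ≤ n)
    (hj : StabilizesTo s (c + j • sVec s) d) :
    Accessible (extend s c (n - ∑ v, c v)) (extend s d (n - ∑ v, d v)) := by
  induction j generalizing d with
  | zero =>
    rw [zero_smul, add_zero] at hj
    obtain rfl := hc.isSStable.eq_of_stabilizesTo hj
    exact .refl
  | succ j ih =>
    obtain ⟨e, he⟩ := exists_stabilizesTo hG (c + j • sVec s)
    have hdm : d ∈ sClass s c := ⟨hc.of_stabilizesTo hj, _, hj⟩
    have hem : e ∈ sClass s c := ⟨hc.of_stabilizesTo he, _, he⟩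
    have h₁ := dLevel_le_classDLevel hdm
    have h₂ := dLevel_le_classDLevel hem
    unfold dLevel at h₁ h₂
    rw [add_smul, one_smul, ← add_assoc] at hj
    have hle : outDeg s ≤ n - ∑ v, e v := by omega
    exact (ih he).trans (.head (legalMove_sink hle)
      (accessible_round (he.of_add hj) hle (by omega)))

theorem isRecurrent_of_classDLevel_le (hG : Quiver.IsStronglyConnected V) {c : SConfig s}
    (hc : IsSRecurrent s c) {n : ℕ} (hn : classDLevel s (sClass s c) ≤ n) :
    IsRecurrent (extend s c (n - ∑ v, c v)) := by
  obtain ⟨m, hm⟩ := hc.exists_period hG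
  obtain ⟨e, he⟩ := exists_stabilizesTo hG (c + sVec s)
  have hem : e ∈ sClass s c := ⟨hc.of_stabilizesTo he, 1, by rwa [one_smul]⟩
  have h₁ := dLevel_le_classDLevel hc.mem_sClass
  have h₂ := dLevel_le_classDLevel hem
  unfold dLevel at h₁ h₂
  have hle : outDeg s ≤ n - ∑ v, c v := by omega
  rw [add_comm m, add_smul, one_smul, ← add_assoc] at hm
  refine isRecurrent_of_closed hG (v := s) (by rwa [extend_self])
    (Relation.ReflTransGen.trans (accessible_round he hle (l := n - ∑ v, e v) (by omega)) ?_)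
  refine accessible_of_classDLevel_le hG hem.1 ?_ (he.of_add hm)
  rwa [sClass_eq_of_mem hG hc hem]

theorem exists_isRecurrent_extend (hG : Quiver.IsStronglyConnected V) {c : SConfig s}
    (hc : IsSRecurrent s c) : ∃ k, IsRecurrent (extend s c k) :=
  ⟨_, isRecurrent_of_classDLevel_le hG hc le_rfl⟩

theorem sLevel_eq_classDLevel (hG : Quiver.IsStronglyConnected V) {c : SConfig s}
    (hc : IsSRecurrent s c) : sLevel s c = classDLevel s (sClass s c) := by
  apply le_antisymm
  · have h : sIndex s c ≤ _ := Nat.sInf_le (isRecurrent_of_classDLevel_le hG hc le_rfl)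
    have h' := dLevel_le_classDLevel hc.mem_sClass
    unfold dLevel at h'
    unfold sLevel
    omega
  · have h : IsRecurrent (extend s c (sIndex s c)) :=
      Nat.sInf_mem (s := {k | IsRecurrent (extend s c k)}) (exists_isRecurrent_extend hG hc)
    exact classDLevel_le_of_isRecurrent hG hc h

end Levels

/-! ### Counting classes -/

section Counting

variable {V : Type u} [Fintype V] [DecidableEq V] [Quiver.{w + 1} V]

/-- The trace of a set `C` of configurations on the `s`-recurrent configurations: those that agree
off `s` with a member of `C`. It takes accessibility classes to `~ₛ`-classes. -/
def sTrace (s : V) (C : Set (V → ℕ)) : Set (SConfig s) :=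
  {x | IsSRecurrent s x ∧ ∃ k, extend s x k ∈ C}

variable [∀ a b : V, Finite (a ⟶ b)] {s : V}

/-- Each class of recurrent configurations contains an extension of an `s`-recurrent
configuration: stabilize off `s`, fire `s`, and return. -/
theorem IsRecurrent.exists_extend (hG : Quiver.IsStronglyConnected V) (s : V) {c : V → ℕ}
    (hc : IsRecurrent c) : ∃ (x : SConfig s) (k : ℕ), IsSRecurrent s x ∧
      Accessible c (extend s x k) := by
  obtain ⟨x, hx⟩ := exists_stabilizesTo hG (s := s) (fun v => c v.1)
  obtain ⟨k, -, hk⟩ := SAccessible.exists_extend hx.1 (c s)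
  rw [extend_restrict] at hk
  refine ⟨x, k, ?_, hk⟩
  have hr := hc.of_accessible hk
  have hback := hr.2 _ (.single (legalMove_sink (hr.outDeg_le hx.2)))
  obtain ⟨m, hm⟩ := hback.restrict s
  rw [fire_extend_sink] at hm
  simp only [extend_val] at hm
  refine isSRecurrent_of_period hG (m := m) ⟨?_, hx.2⟩
  rw [add_comm m, add_smul, one_smul, ← add_assoc]
  exact hm

theorem sTrace_recClass (hG : Quiver.IsStronglyConnected V) {x : SConfig s} {k : ℕ}
    (hx : IsSRecurrent s x) (h : IsRecurrent (extend s x k)) :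
    sTrace s (recClass (extend s x k)) = sClass s x := by
  ext y
  constructor
  · rintro ⟨hy, l, -, hl⟩
    obtain ⟨m, hm⟩ := hl.restrict s
    simp only [extend_val] at hm
    exact ⟨hy, m, hm, hy.isSStable⟩
  · rintro ⟨hy, hxy⟩
    obtain ⟨l, -, hl⟩ := h.exists_accessible hG hx.isSStable hxy
    exact ⟨hy, l, h.of_accessible hl, hl⟩

/-- The representative of a class of level `n` as an extension of an `s`-recurrent
configuration. -/
theorem exists_of_mem_recClassesOfLevel (hG : Quiver.IsStronglyConnected V) (s : V) {n : ℕ}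
    {C : Set (V → ℕ)} (hC : C ∈ recClassesOfLevel V n) :
    ∃ (x : SConfig s) (k : ℕ), IsSRecurrent s x ∧ IsRecurrent (extend s x k) ∧
      k + ∑ v, x v = n ∧ C = recClass (extend s x k) := by
  obtain ⟨c, ⟨hc, rfl⟩, rfl⟩ := hC
  obtain ⟨x, k, hx, hk⟩ := hc.exists_extend hG s
  have hr := hc.of_accessible hk
  exact ⟨x, k, hx, hr, by rw [← level_extend, level_eq_of_accessible hk],
    (recClass_eq_iff hc hr).2 hk⟩

theorem injOn_sTrace (hG : Quiver.IsStronglyConnected V) (s : V) (n : ℕ) :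
    Set.InjOn (sTrace s) (recClassesOfLevel V n) := by
  intro C hC D hD hCD
  obtain ⟨x, k, hx, hr, hxn, rfl⟩ := exists_of_mem_recClassesOfLevel hG s hC
  obtain ⟨y, l, hy, hr', hyn, rfl⟩ := exists_of_mem_recClassesOfLevel hG s hD
  rw [sTrace_recClass hG hx hr, sTrace_recClass hG hy hr'] at hCD
  have hyx : y ∈ sClass s x := hCD ▸ hy.mem_sClass
  obtain ⟨l', hl', hacc⟩ := hr.exists_accessible hG hx.isSStable hyx.2
  obtain rfl : l' = l := by omega
  exact (recClass_eq_iff hr hr').2 hacc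

theorem image_sTrace (hG : Quiver.IsStronglyConnected V) (s : V) (n : ℕ) :
    sTrace s '' recClassesOfLevel V n = {A ∈ sClasses s | classDLevel s A ≤ n} := by
  ext A
  constructor
  · rintro ⟨C, hC, rfl⟩
    obtain ⟨x, k, hx, hr, rfl, rfl⟩ := exists_of_mem_recClassesOfLevel hG s hC
    rw [sTrace_recClass hG hx hr]
    exact ⟨⟨x, hx, rfl⟩, classDLevel_le_of_isRecurrent hG hx hr⟩
  · rintro ⟨⟨x, hx, rfl⟩, hn⟩
    have hr := isRecurrent_of_classDLevel_le hG hx hn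
    refine ⟨_, ⟨_, ⟨hr, ?_⟩, rfl⟩, sTrace_recClass hG hx hr⟩
    have := dLevel_le_classDLevel hx.mem_sClass
    unfold dLevel at this
    rw [level_extend]
    omega

theorem ncard_recClassesOfLevel (hG : Quiver.IsStronglyConnected V) (s : V) (n : ℕ) :
    (recClassesOfLevel V n).ncard = {A ∈ sClasses s | classDLevel s A ≤ n}.ncard := by
  rw [← image_sTrace hG, (injOn_sTrace hG s n).ncard_image]

theorem sClassesOfLevel_eq (hG : Quiver.IsStronglyConnected V) (s : V) (n : ℕ) :
    sClassesOfLevel s n = {A ∈ sClasses s | classDLevel s A = n} := by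
  ext A
  constructor
  · rintro ⟨c, ⟨hc, rfl⟩, rfl⟩
    exact ⟨⟨c, hc, rfl⟩, (sLevel_eq_classDLevel hG hc).symm⟩
  · rintro ⟨⟨c, hc, rfl⟩, rfl⟩
    exact ⟨c, ⟨hc, sLevel_eq_classDLevel hG hc⟩, rfl⟩

theorem coe_biggsMerino (hG : Quiver.IsStronglyConnected V) (s : V) :
    (biggsMerino s : PowerSeries ℤ) = sSeries s := by
  ext n
  rw [Polynomial.coeff_coe, sSeries, PowerSeries.coeff_mk, sClassesOfLevel_eq hG, biggsMerino,
    Polynomial.finsetSum_coeff]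
  simp only [Polynomial.coeff_X_pow, Finset.sum_boole]
  rw [← Set.ncard_coe_finset]
  congr 2
  ext A
  simp [eq_comm]

theorem sSeries_eq (hG : Quiver.IsStronglyConnected V) (s : V) :
    sSeries s = (1 - PowerSeries.X) * recSeries V := by
  ext n
  rw [sub_mul, one_mul, map_sub, sSeries, recSeries, PowerSeries.coeff_mk, PowerSeries.coeff_mk,
    sClassesOfLevel_eq hG, ncard_recClassesOfLevel hG s]
  cases n with
  | zero => simp
  | succ n =>
    rw [PowerSeries.coeff_succ_X_mul, PowerSeries.coeff_mk, ncard_recClassesOfLevel hG s]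
    have hU : {A ∈ sClasses s | classDLevel s A ≤ n + 1} =
        {A ∈ sClasses s | classDLevel s A = n + 1} ∪ {A ∈ sClasses s | classDLevel s A ≤ n} := by
      ext A
      simp only [Set.mem_ofPred_eq, Set.mem_union, ← and_or_left, Nat.le_succ_iff, or_comm]
    have hdisj : Disjoint {A ∈ sClasses s | classDLevel s A = n + 1}
        {A ∈ sClasses s | classDLevel s A ≤ n} := by
      rw [Set.disjoint_left]
      rintro A ⟨-, h₁⟩ ⟨-, h₂⟩
      omega
    rw [hU, Set.ncard_union_eq hdisj ((finite_sClasses s).subset (Set.sep_subset _ _))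
      ((finite_sClasses s).subset (Set.sep_subset _ _))]
    push_cast
    ring

end Counting

end Sandpile

/-- For each sink `s`, the first three conjuncts say that the objects of the result are well
defined: `~ₛ` is an equivalence relation on the `s`-recurrent configurations, the `s`-index exists,
and the `s`-level depends only on the class, being the `d`-level of the class. -/
theorem theorem4p2 {V : Type u} [Fintype V] [DecidableEq V] [Quiver.{w + 1} V]
    [∀ a b : V, Finite (a ⟶ b)] (hG : Quiver.IsStronglyConnected V) :
    (∀ s : V,
      Equivalence (fun c d : {c : Sandpile.SConfig s // Sandpile.IsSRecurrent s c} =>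
        Sandpile.SEquiv s c.1 d.1) ∧
      (∀ c : Sandpile.SConfig s, Sandpile.IsSRecurrent s c →
        ∃ k : ℕ, Sandpile.IsRecurrent (Sandpile.extend s c k)) ∧
      (∀ c : Sandpile.SConfig s, Sandpile.IsSRecurrent s c →
        Sandpile.sLevel s c = Sandpile.classDLevel s (Sandpile.sClass s c)) ∧
      (Sandpile.biggsMerino s : PowerSeries ℤ) = Sandpile.sSeries s ∧
      Sandpile.sSeries s = (1 - PowerSeries.X) * Sandpile.recSeries V) ∧
    ∀ s t : V, Sandpile.biggsMerino s = Sandpile.biggsMerino t := by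
  refine ⟨fun s => ⟨Sandpile.equivalence_sEquiv hG s,
    fun _ hc => Sandpile.exists_isRecurrent_extend hG hc,
    fun _ hc => Sandpile.sLevel_eq_classDLevel hG hc,
    Sandpile.coe_biggsMerino hG s, Sandpile.sSeries_eq hG s⟩, fun s t => ?_⟩
  apply Polynomial.coe_injective ℤ
  rw [Sandpile.coe_biggsMerino hG, Sandpile.coe_biggsMerino hG, Sandpile.sSeries_eq hG,
    Sandpile.sSeries_eq hG]
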